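/- Let $\alpha\in(0,2)\setminus\{1\}$, let $p\in[1,\infty)$, let $E=\ell^p(\mathbb Z)$ be the space of complex $p$-summable sequences with canonical basis $(e_n)_{n\in\mathbb Z}$, and let $\langle\cdot,\cdot\rangle:E\times E^*\to\mathbb C$ be the (bilinear) duality pairing. Let $(\omega_n)_{n\in\mathbb Z}$ be positive weights and $k_0>0$ a constant such that the sequence $$k_n:=k_0\mathbf 1_{\{n\le -1\}}\prod_{l=n+1}^{0}\frac1{\omega_l}+k_0\mathbf 1_{\{n\ge 0\}}\prod_{l=1}^{n}\omega_l,\qquad n\in\mathbb Z,$$ belongs to $\ell^\alpha(\mathbb Z)$. Let $\mu$ be the $\alpha$-stable probability measure on $E$ with control measure $\xi=\frac12\sum_{n\in\mathbb Z}k_n^\alpha(\delta_{e_n}+\delta_{ie_n})$, i.e. the Borel probability measure such that $$\int_E e^{i\,\mathrm{Re}\langle z,x^*\rangle}\,\mu(dz)=\exp\Big(-\int_E|\mathrm{Re}\langle z,x^*\rangle|^\alpha\,\xi(dz)\Big),\qquad x^*\in E^*$$ (assumed to exist), and let $T$ be the weighted forward shift on $E$, i.e. the bounded linear operator with $Te_n=\omega_{n+1}e_{n+1}$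 for $n\in\mathbb Z$ (assumed to be bounded). For $x^*,y^*\in E^*$ put $$C^{=}_\mu(x^*,y^*):=\log\int_E e^{i\,\mathrm{Re}\langle z,x^*-y^*\rangle}\mu(dz)-\log\int_E e^{i\,\mathrm{Re}\langle z,x^*\rangle}\mu(dz)-\log\int_E e^{-i\,\mathrm{Re}\langle z,y^*\rangle}\mu(dz),$$ $$C^{\ne}_\mu(x^*,y^*):=\log\int_E e^{i\,\mathrm{Re}\langle z,x^*\rangle-i\,\mathrm{Im}\langle z,y^*\rangle}\mu(dz)-\log\int_E e^{i\,\mathrm{Re}\langle z,x^*\rangle}\mu(dz)-\log\int_E e^{-i\,\mathrm{Im}\langle z,y^*\rangle}\mu(dz).$$ 1. $T$ leaves $\mu$ invariant. 2. Assume moreover that $p\in(\alpha,2]\cap[1,2]$ and that there are integers $q_-\ge0$, $q_+\ge1$ such that $$\eta_-:=\sup_{l\le -q_-}\frac1{\omega_l}<1,\qquad \eta_+:=\sup_{l\ge q_+}\omega_l<1,\qquad \eta_+^{p/2}\ne\eta_-^{\alpha-p/2}.$$ Then there is a constant $K>0$, independent of $n$, $x^*$ and $y^*$, such that for each of $C_\mu=C^{=}_\mu$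 and $C_\mu=C^{\ne}_\mu$, $$\sup_{x^*,y^*\in E^*\setminus\{0\}}\frac{|C_\mu(x^*,T^{*n}y^*)|}{\|x^*\|^{\alpha/2}\|y^*\|^{\alpha/2}}\le K\,\max\big(\eta_-^{2\alpha/p-1},\eta_+\big)^{\alpha n/2},\qquad n\ge0.$$ In particular, if in addition $\alpha\in(1/2,2)\setminus\{1\}$ and $p\in(\alpha,2\alpha)\cap[1,2]$, then $T$ is mixing with respect to $\mu$, i.e. $T$ preserves $\mu$ and $\mu(A\cap T^{-n}(B))\to\mu(A)\mu(B)$ as $n\to\infty$ for all Borel sets $A,B\subset E$. -/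

import Mathlib

open MeasureTheory Filter Topology
open scoped NNReal ENNReal

noncomputable section

/-- The complex sequence space `ℓ^p(ℤ)`, with its usual norm. -/
abbrev EllP (p : ℝ≥0) : Type := lp (fun _ : ℤ => ℂ) (p : ℝ≥0∞)

/-- The canonical basis vector `e_n` of `ℓ^p(ℤ)`. -/
def basisVec (p : ℝ≥0) (n : ℤ) : EllP p := lp.single (p : ℝ≥0∞) n (1 : ℂ)

/-- The sequence built from the weights: `k_n = k₀ ∏_{l=n+1}^0 1/ω_l` for `n ≤ -1` and
`k_n = k₀ ∏_{l=1}^n ω_l` for `n ≥ 0`. -/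
def weightSeq (ω : ℤ → ℝ) (k₀ : ℝ) (n : ℤ) : ℝ :=
  if n ≤ -1 then k₀ * ∏ l ∈ Finset.Icc (n + 1) 0, 1 / ω l
  else k₀ * ∏ l ∈ Finset.Icc 1 n, ω l

/-- The control measure `½ ∑_n k_n^α (δ_{e_n} + δ_{i e_n})` on `ℓ^p(ℤ)`. -/
def controlMeasure (p : ℝ≥0) [MeasurableSpace (EllP p)] (α : ℝ) (k : ℤ → ℝ) :
    Measure (EllP p) :=
  Measure.sum fun n : ℤ => ENNReal.ofReal (k n ^ α / 2) •
    (Measure.dirac (basisVec p n) + Measure.dirac (Complex.I • basisVec p n))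

section Banach

variable {E : Type*} [NormedAddCommGroup E] [NormedSpace ℂ E] [MeasurableSpace E]

/-- `μ` is the (symmetric) `α`-stable measure with control measure `ξ`, i.e. its characteristic
functional is `x* ↦ exp (-∫ |Re ⟨z, x*⟩|^α ξ(dz))`. The dual pairing `⟨z, x*⟩` is `x* z`. -/
def IsStableWithControl (α : ℝ) (ξ μ : Measure E) : Prop :=
  ∀ x : StrongDual ℂ E,
    ∫ z, Complex.exp (Complex.I * ((x z).re : ℂ)) ∂μ
      = Complex.exp (-((∫ z, |(x z).re| ^ α ∂ξ : ℝ) : ℂ))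

/-- The codifference `C^=_μ(x*, y*)`. For the stable measures above all three characteristic
functionals are positive real numbers, so that the logarithm is the ordinary real one. -/
def codiffEq (μ : Measure E) (x y : StrongDual ℂ E) : ℂ :=
  Complex.log (∫ z, Complex.exp (Complex.I * (((x - y) z).re : ℂ)) ∂μ)
    - Complex.log (∫ z, Complex.exp (Complex.I * ((x z).re : ℂ)) ∂μ)
    - Complex.log (∫ z, Complex.exp (-(Complex.I * ((y z).re : ℂ))) ∂μ)

/-- The codifference `C^≠_μ(x*, y*)`. Since `Im ⟨z, y*⟩ = Re ⟨z, -i y*⟩`, the arguments of the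
logarithms are again positive real numbers for the stable measures above. -/
def codiffNe (μ : Measure E) (x y : StrongDual ℂ E) : ℂ :=
  Complex.log (∫ z, Complex.exp (Complex.I * ((x z).re : ℂ) - Complex.I * ((y z).im : ℂ)) ∂μ)
    - Complex.log (∫ z, Complex.exp (Complex.I * ((x z).re : ℂ)) ∂μ)
    - Complex.log (∫ z, Complex.exp (-(Complex.I * ((y z).im : ℂ))) ∂μ)

/-- The adjoint power `T^{*n} y*`, i.e. `⟨z, T^{*n} y*⟩ = ⟨T^n z, y*⟩`. -/
def adjPow (T : E →L[ℂ] E) (n : ℕ) (y : StrongDual ℂ E) : StrongDual ℂ E :=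
  y.comp (T ^ n)

/-- `T` is (strongly) mixing with respect to `μ`: it preserves `μ` and
`μ (A ∩ T^{-n} B) → μ A * μ B` for all measurable `A`, `B`. -/
structure IsMixing (T : E → E) (μ : Measure E) : Prop where
  measurePreserving : MeasurePreserving T μ μ
  tendsto : ∀ A B : Set E, MeasurableSet A → MeasurableSet B →
    Tendsto (fun n : ℕ => μ (A ∩ T^[n] ⁻¹' B)) atTop (𝓝 (μ A * μ B))

end Banach

end

/-! ### An elementary inequality for powers. -/

section RealInequality

/-! The characteristic functional of `μ` is `exp (-Φ x)`, where `Φ` is a sum of `k_n ^ α` times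
powers of the real and imaginary parts of the coordinates `x e_n`. Since `k_(n+1) = ω_(n+1) k_n`,
the operator `T` moves `k_n e_n` to `k_(n+1) e_(n+1)`. Reindexing shows that `Φ` is unchanged by the
adjoint, and invariance follows because characteristic functionals determine measures.

The codifference is `Φ x + Φ y - Φ (x - y)`. The scalar inequality `abs_rpow_add_sub_rpow_sub_le`
bounds it at `(x, T^{*n} y)` by a multiple of `(‖x‖ ‖y‖) ^ (α/2) * ∑_m (k_m k_(m+n)) ^ (α/2)`. The
weights decay at rate `ηm` on the left and at most `ρ` on the right. With `ηm < ρ < 1`,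
`exists_weightSeq_mul_le` gives `k_m k_(m+n) ≤ C ρ^n t^|m|` for some `t < 1`, so the sum is of order
`ρ ^ (α n / 2)`. The second codifference is the first one at `-i y`.

For mixing, vanishing codifferences make the correlations of characters converge to products.
Characters span a dense subspace of `L²(μ)`, and uniform boundedness of the Koopman powers extends
this to indicators. -/

theorem abs_rpow_sub_rpow_le {u v s : ℝ} (hu : 0 ≤ u) (hv : 0 ≤ v) (hs0 : 0 ≤ s) (hs1 : s ≤ 1) :
    |u ^ s - v ^ s| ≤ |u - v| ^ s := by
  have aux : ∀ {a b : ℝ}, 0 ≤ b → b ≤ a → |a ^ s - b ^ s| ≤ |a - b| ^ s := by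
    intro a b hb hab
    have h := Real.rpow_add_le_add_rpow (sub_nonneg.2 hab) hb hs0 hs1
    rw [sub_add_cancel] at h
    rw [abs_of_nonneg (sub_nonneg.2 hab),
      abs_of_nonneg (sub_nonneg.2 (Real.rpow_le_rpow hb hab hs0))]
    linarith
  rcases le_total v u with h | h
  · exact aux hv h
  · rw [abs_sub_comm, abs_sub_comm u]
    exact aux hu h

/-- With `A`, `B`, `D` the `α/2`-th powers of `|a|`, `|b|`, `|a - b|`, subadditivity (`α/2 ≤ 1`)
gives `|A - D| ≤ B`. Factoring `A² - D²` then extracts a factor `B`; the ordering `B ≤ A` absorbs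
the rest. -/
theorem abs_rpow_add_sub_rpow_sub_le {α : ℝ} (h0 : 0 < α) (h2 : α ≤ 2) (a b : ℝ) :
    |(|a| ^ α + |b| ^ α - |a - b| ^ α)| ≤ 4 * (|a| ^ (α / 2) * |b| ^ (α / 2)) := by
  wlog hab : |b| ≤ |a| generalizing a b
  · have := this b a (le_of_not_ge hab)
    rwa [add_comm, abs_sub_comm b a, mul_comm (_ ^ _)] at this
  have hs0 : 0 < α / 2 := by positivity
  have hsq : ∀ {t : ℝ}, 0 ≤ t → t ^ α = t ^ (α / 2) * t ^ (α / 2) := fun ht => by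
    rw [← Real.rpow_add_of_nonneg ht hs0.le hs0.le, add_halves]
  have hA : 0 ≤ |a| ^ (α / 2) := by positivity
  have hB : 0 ≤ |b| ^ (α / 2) := by positivity
  have hBA : |b| ^ (α / 2) ≤ |a| ^ (α / 2) := Real.rpow_le_rpow (abs_nonneg b) hab hs0.le
  have h3 : |(|a| ^ (α / 2) - |a - b| ^ (α / 2))| ≤ |b| ^ (α / 2) :=
    (abs_rpow_sub_rpow_le (abs_nonneg _) (abs_nonneg _) hs0.le (by linarith)).trans
      (Real.rpow_le_rpow (abs_nonneg _) (by
        simpa using abs_abs_sub_abs_le a (a - b)) hs0.le)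
  have h4 : |a - b| ^ (α / 2) ≤ 2 * |a| ^ (α / 2) := by
    have := (abs_le.1 h3).1
    linarith
  have hC : 0 ≤ |a - b| ^ (α / 2) := by positivity
  rw [hsq (abs_nonneg a), hsq (abs_nonneg b), hsq (abs_nonneg (a - b))]
  generalize |a| ^ (α / 2) = A at *
  generalize |b| ^ (α / 2) = B at *
  generalize |a - b| ^ (α / 2) = D at *
  calc |A * A + B * B - D * D| = |(A - D) * (A + D) + B * B| := by ring_nf
    _ ≤ |(A - D) * (A + D)| + |B * B| := abs_add_le _ _
    _ = |A - D| * (A + D) + B * B := by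
        rw [abs_mul, abs_of_nonneg (add_nonneg hA hC), abs_of_nonneg (mul_nonneg hB hB)]
    _ ≤ B * (A + 2 * A) + A * B := by gcongr
    _ = 4 * (A * B) := by ring

end RealInequality

/-! ### The exponent of the stable law and its codifference. -/

section StableExponent

/-- The exponent `∑ k_n^α / 2 (|Re x_n|^α + |Im x_n|^α)` of the stable law, as a function of the
sequence of coordinates of a functional. -/
noncomputable def stableExponent (α : ℝ) (k : ℤ → ℝ) (x : ℤ → ℂ) : ℝ :=
  ∑' n, k n ^ α / 2 * (|(x n).re| ^ α + |(x n).im| ^ α)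

theorem summable_stableExponent {α : ℝ} (h0 : 0 < α) {k : ℤ → ℝ} (hk0 : ∀ n, 0 ≤ k n)
    (hk : Summable fun n => k n ^ α) {x : ℤ → ℂ} {M : ℝ} (hx : ∀ n, ‖x n‖ ≤ M) :
    Summable fun n => k n ^ α / 2 * (|(x n).re| ^ α + |(x n).im| ^ α) := by
  refine Summable.of_nonneg_of_le (fun n => ?_) (fun n => ?_) (hk.mul_right (M ^ α))
  · have := Real.rpow_nonneg (hk0 n) α
    positivity
  · have := Real.rpow_nonneg (hk0 n) α
    have h1 : |(x n).re| ^ α ≤ M ^ α :=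
      Real.rpow_le_rpow (abs_nonneg _) ((Complex.abs_re_le_norm _).trans (hx n)) h0.le
    have h2 : |(x n).im| ^ α ≤ M ^ α :=
      Real.rpow_le_rpow (abs_nonneg _) ((Complex.abs_im_le_norm _).trans (hx n)) h0.le
    calc k n ^ α / 2 * (|(x n).re| ^ α + |(x n).im| ^ α) ≤ k n ^ α / 2 * (M ^ α + M ^ α) := by
          gcongr
      _ = k n ^ α * M ^ α := by ring

theorem abs_stableExponent_codifference_le {α : ℝ} (h0 : 0 < α) (h2 : α ≤ 2) {k : ℤ → ℝ}
    (hk0 : ∀ n, 0 ≤ k n) (hk : Summable fun n => k n ^ α) {x y : ℤ → ℂ} {M N : ℝ}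
    (hx : ∀ n, ‖x n‖ ≤ M) (hy : ∀ n, ‖y n‖ ≤ N)
    (hxy : Summable fun n => k n ^ α * (‖x n‖ ^ (α / 2) * ‖y n‖ ^ (α / 2))) :
    |stableExponent α k x + stableExponent α k y - stableExponent α k (fun n => x n - y n)|
      ≤ 4 * ∑' n, k n ^ α * (‖x n‖ ^ (α / 2) * ‖y n‖ ^ (α / 2)) := by
  have hsx := summable_stableExponent h0 hk0 hk hx
  have hsy := summable_stableExponent h0 hk0 hk hy
  have hsd := summable_stableExponent h0 hk0 hk (x := fun n => x n - y n) (M := M + N)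
    fun n => (norm_sub_le _ _).trans (add_le_add (hx n) (hy n))
  rw [stableExponent, stableExponent, stableExponent, ← hsx.tsum_add hsy,
    ← (hsx.add hsy).tsum_sub hsd, ← Real.norm_eq_abs, ← tsum_mul_left]
  refine tsum_of_norm_bounded (hxy.mul_left 4).hasSum fun n => ?_
  have hkn := Real.rpow_nonneg (hk0 n) α
  have hre := abs_rpow_add_sub_rpow_sub_le h0 h2 (x n).re (y n).re
  have him := abs_rpow_add_sub_rpow_sub_le h0 h2 (x n).im (y n).im
  have bre : |(x n).re| ^ (α / 2) * |(y n).re| ^ (α / 2) ≤ ‖x n‖ ^ (α / 2) * ‖y n‖ ^ (α / 2) := by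
    gcongr <;> exact Complex.abs_re_le_norm _
  have bim : |(x n).im| ^ (α / 2) * |(y n).im| ^ (α / 2) ≤ ‖x n‖ ^ (α / 2) * ‖y n‖ ^ (α / 2) := by
    gcongr <;> exact Complex.abs_im_le_norm _
  rw [Real.norm_eq_abs, Complex.sub_re, Complex.sub_im]
  calc _ = |k n ^ α / 2 * ((|(x n).re| ^ α + |(y n).re| ^ α - |(x n).re - (y n).re| ^ α)
        + (|(x n).im| ^ α + |(y n).im| ^ α - |(x n).im - (y n).im| ^ α))| := by ring_nf
    _ ≤ k n ^ α / 2 * (4 * (‖x n‖ ^ (α / 2) * ‖y n‖ ^ (α / 2))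
        + 4 * (‖x n‖ ^ (α / 2) * ‖y n‖ ^ (α / 2))) := by
      rw [abs_mul, abs_of_nonneg (by positivity : 0 ≤ k n ^ α / 2)]
      refine mul_le_mul_of_nonneg_left ((abs_add_le _ _).trans ?_) (by positivity)
      gcongr <;> linarith
    _ = _ := by ring

end StableExponent

/-! ### Characteristic functional and codifferences in coordinates. -/

section EllP

variable {p : ℝ≥0} [Fact (1 ≤ (p : ℝ≥0∞))]

theorem norm_apply_basisVec_le (x : StrongDual ℂ (EllP p)) (n : ℤ) :
    ‖x (basisVec p n)‖ ≤ ‖x‖ := by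
  have h := x.le_opNorm (basisVec p n)
  rwa [basisVec, lp.norm_single (zero_lt_one.trans_le Fact.out), norm_one, mul_one] at h

/-- Needed for characteristic functionals to determine Borel measures; finiteness of `p` makes the
basis expansions converge. -/
instance separableSpace_ellP : TopologicalSpace.SeparableSpace (EllP p) := by
  have hc : (Set.range (basisVec p)).Countable := Set.countable_range _
  have hs := (hc.isSeparable.span (R := ℂ)).closure
  refine TopologicalSpace.isSeparable_univ_iff.1 (hs.mono fun f _ => ?_)
  refine mem_closure_of_tendsto (lp.hasSum_single ENNReal.coe_ne_top f)
    (.of_forall fun s => Submodule.sum_mem _ fun i _ => ?_)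
  have : lp.single (p : ℝ≥0∞) i (f i) = f i • basisVec p i := by
    rw [basisVec, ← lp.single_smul, smul_eq_mul, mul_one]
  rw [this]
  exact Submodule.smul_mem _ _ (Submodule.subset_span ⟨i, rfl⟩)

variable [MeasurableSpace (EllP p)] [BorelSpace (EllP p)]

/-- The atoms at `i e_n` produce the imaginary parts, since `Re (i w) = -Im w`. -/
theorem integral_controlMeasure {α : ℝ} (h0 : 0 < α) {k : ℤ → ℝ} (hk0 : ∀ n, 0 ≤ k n)
    (hk : Summable fun n => k n ^ α) (x : StrongDual ℂ (EllP p)) :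
    ∫ z, |(x z).re| ^ α ∂(controlMeasure p α k)
      = stableExponent α k fun n => x (basisVec p n) := by
  have hint : ∀ n, ∀ f : EllP p → ℝ, ∫ z, f z ∂(ENNReal.ofReal (k n ^ α / 2) •
      (Measure.dirac (basisVec p n) + Measure.dirac (Complex.I • basisVec p n)))
      = k n ^ α / 2 * (f (basisVec p n) + f (Complex.I • basisVec p n)) := by
    intro n f
    rw [integral_smul_measure, integral_add_measure (integrable_dirac (by simp))
      (integrable_dirac (by simp)), integral_dirac, integral_dirac, smul_eq_mul,
      ENNReal.toReal_ofReal (div_nonneg (Real.rpow_nonneg (hk0 n) α) two_pos.le)]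
  have hI : Integrable (fun z => |(x z).re| ^ α) (controlMeasure p α k) := by
    refine integrable_sum_measure (fun n => ?_) ?_
    · exact (Integrable.add_measure (integrable_dirac (by simp))
        (integrable_dirac (by simp))).smul_measure ENNReal.ofReal_ne_top
    · simp only [hint]
      refine (summable_stableExponent h0 hk0 hk (norm_apply_basisVec_le x)).congr fun n => ?_
      simp [Real.abs_rpow_of_nonneg]
  rw [controlMeasure, integral_sum_measure hI, stableExponent]
  refine tsum_congr fun n => ?_
  rw [hint]
  simp

variable {α : ℝ} {k : ℤ → ℝ} {μ : Measure (EllP p)}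

theorem IsStableWithControl.integral_exp_re (hμ : IsStableWithControl α (controlMeasure p α k) μ)
    (h0 : 0 < α) (hk0 : ∀ n, 0 ≤ k n) (hk : Summable fun n => k n ^ α)
    (x : StrongDual ℂ (EllP p)) :
    ∫ z, Complex.exp (Complex.I * ((x z).re : ℂ)) ∂μ
      = (Real.exp (-stableExponent α k fun n => x (basisVec p n)) : ℂ) := by
  rw [hμ x, integral_controlMeasure h0 hk0 hk]
  push_cast
  rfl

theorem IsStableWithControl.codiffEq_eq (hμ : IsStableWithControl α (controlMeasure p α k) μ)
    (h0 : 0 < α) (hk0 : ∀ n, 0 ≤ k n) (hk : Summable fun n => k n ^ α)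
    (x y : StrongDual ℂ (EllP p)) :
    codiffEq μ x y = ((stableExponent α k (fun n => x (basisVec p n))
      + stableExponent α k (fun n => y (basisVec p n))
      - stableExponent α k (fun n => x (basisVec p n) - y (basisVec p n)) : ℝ) : ℂ) := by
  have hy : ∫ z, Complex.exp (-(Complex.I * ((y z).re : ℂ))) ∂μ
      = (Real.exp (-stableExponent α k fun n => y (basisVec p n)) : ℂ) := by
    have := hμ.integral_exp_re h0 hk0 hk (-y)
    simpa [stableExponent] using this
  rw [codiffEq, hy, hμ.integral_exp_re h0 hk0 hk x, hμ.integral_exp_re h0 hk0 hk (x - y),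
    ← Complex.ofReal_log (Real.exp_pos _).le, ← Complex.ofReal_log (Real.exp_pos _).le,
    ← Complex.ofReal_log (Real.exp_pos _).le, Real.log_exp, Real.log_exp, Real.log_exp,
    ← Complex.ofReal_sub, ← Complex.ofReal_sub]
  congr 1
  simp only [sub_apply]
  ring

end EllP

/-- `Im w = Re (-i w)`, and rotating `y` by `-i` preserves its norm, so estimates for one
codifference transfer to the other. -/
theorem codiffNe_eq_codiffEq {E : Type*} [NormedAddCommGroup E] [NormedSpace ℂ E]
    [MeasurableSpace E] (μ : Measure E) (x y : StrongDual ℂ E) :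
    codiffNe μ x y = codiffEq μ x (-(Complex.I • y)) := by
  simp [codiffNe, codiffEq, sub_eq_add_neg, mul_add]

/-! ### Characters in `L²(μ)` and a criterion for mixing. -/

section Mixing

variable {E : Type*} [NormedAddCommGroup E] [NormedSpace ℂ E] [MeasurableSpace E] [BorelSpace E]

/-- Two finite measures on a separable complex Banach space with the same characteristic
functional are equal. -/
theorem ext_of_integral_exp_re [CompleteSpace E] [SecondCountableTopology E]
    {μ ν : Measure E} [IsFiniteMeasure μ] [IsFiniteMeasure ν]
    (h : ∀ x : StrongDual ℂ E, ∫ z, Complex.exp (Complex.I * ((x z).re : ℂ)) ∂μ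
      = ∫ z, Complex.exp (Complex.I * ((x z).re : ℂ)) ∂ν) : μ = ν := by
  let : NormedSpace ℝ E := NormedSpace.restrictScalars ℝ ℂ E
  have : IsScalarTower ℝ ℂ E := inferInstance
  refine Measure.ext_of_charFunDual (funext fun L => ?_)
  -- Every real functional is the real part of a complex one.
  have key : ∀ z, (L.extendRCLike (𝕜 := ℂ) z).re = L z := fun z => by
    simp [StrongDual.extendRCLike_apply]
  simpa only [charFunDual_apply, key, mul_comm Complex.I] using h (L.extendRCLike (𝕜 := ℂ))

theorem measurable_exp_re (x : StrongDual ℂ E) :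
    Measurable fun z => Complex.exp (Complex.I * ((x z).re : ℂ)) :=
  Continuous.measurable (by fun_prop)

theorem norm_exp_re {F : Type*} [NormedAddCommGroup F] [NormedSpace ℂ F]
    (x : StrongDual ℂ F) (z : F) :
    ‖Complex.exp (Complex.I * ((x z).re : ℂ))‖ = 1 := by
  rw [mul_comm, Complex.norm_exp_ofReal_mul_I]

theorem memLp_exp_re (μ : Measure E) [IsFiniteMeasure μ] (x : StrongDual ℂ E) :
    MemLp (fun z => Complex.exp (Complex.I * ((x z).re : ℂ))) 2 μ :=
  .of_bound (measurable_exp_re x).aestronglyMeasurable 1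
    (ae_of_all _ fun z => (norm_exp_re x z).le)

/-- The character `z ↦ exp (i Re ⟨z, x⟩)` as an element of `L²(μ)`. -/
noncomputable def charLp (μ : Measure E) [IsFiniteMeasure μ] (x : StrongDual ℂ E) : Lp ℂ 2 μ :=
  (memLp_exp_re μ x).toLp _

/-- The positive and negative parts of `u` are densities of two finite measures with the same
characteristic functional, so these parts agree almost everywhere. -/
theorem ae_eq_zero_of_integral_mul_exp_re [CompleteSpace E] [SecondCountableTopology E]
    {μ : Measure E} [IsFiniteMeasure μ] {u : E → ℝ} (hu : Integrable u μ)
    (h : ∀ x : StrongDual ℂ E, ∫ z, (u z : ℂ) * Complex.exp (Complex.I * ((x z).re : ℂ)) ∂μ = 0) :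
    u =ᵐ[μ] 0 := by
  have hm : AEMeasurable (fun z => ENNReal.ofReal (u z)) μ := hu.aemeasurable.ennreal_ofReal
  have hm' : AEMeasurable (fun z => ENNReal.ofReal (-u z)) μ := hu.neg.aemeasurable.ennreal_ofReal
  have h1 : IsFiniteMeasure (μ.withDensity fun z => ENNReal.ofReal (u z)) :=
    isFiniteMeasure_withDensity_ofReal hu.2
  have h2 : IsFiniteMeasure (μ.withDensity fun z => ENNReal.ofReal (-u z)) :=
    isFiniteMeasure_withDensity_ofReal hu.neg.2
  have hν : (μ.withDensity fun z => ENNReal.ofReal (u z))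
      = μ.withDensity fun z => ENNReal.ofReal (-u z) := by
    refine ext_of_integral_exp_re fun x => ?_
    rw [integral_withDensity_eq_integral_toReal_smul₀ hm (by simp),
      integral_withDensity_eq_integral_toReal_smul₀ hm' (by simp), ← sub_eq_zero,
      ← integral_sub, ← h x]
    · refine integral_congr_ae (ae_of_all _ fun z => ?_)
      simp only [ENNReal.toReal_ofReal', Complex.real_smul, ← sub_mul, ← Complex.ofReal_sub]
      rw [max_zero_sub_eq_self]
    all_goals
      simp only [ENNReal.toReal_ofReal']
      refine Integrable.mono (g := u) hu ?_ (ae_of_all _ fun z => ?_)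
      · refine AEStronglyMeasurable.smul (𝕜 := ℝ) ?_ (measurable_exp_re x).aestronglyMeasurable
        first
        | exact (hu.aemeasurable.max aemeasurable_const).aestronglyMeasurable
        | exact (hu.aemeasurable.neg.max aemeasurable_const).aestronglyMeasurable
      · rw [norm_smul, norm_exp_re, mul_one, Real.norm_eq_abs, Real.norm_eq_abs]
        rcases le_total 0 (u z) with h0 | h0 <;> simp [h0]
  have := (withDensity_eq_iff hm hm' (by
    have := h1.measure_univ_lt_top
    rw [withDensity_apply _ MeasurableSet.univ, Measure.restrict_univ] at this
    exact this.ne)).1 hν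
  filter_upwards [this] with z hz
  have := congrArg ENNReal.toReal hz
  simp only [ENNReal.toReal_ofReal'] at this
  rcases le_total 0 (u z) with h0 | h0 <;> simp [h0] at this <;> simp [this]

/-- If `f` is orthogonal to all characters, so is its conjugate, because characters are stable under
conjugation. Hence the real and imaginary parts of `f` have vanishing transforms separately. -/
theorem span_range_charLp_topologicalClosure [CompleteSpace E] [SecondCountableTopology E]
    (μ : Measure E) [IsFiniteMeasure μ] :
    (Submodule.span ℂ (Set.range (charLp μ))).topologicalClosure = ⊤ := by
  rw [Submodule.topologicalClosure_eq_top_iff, Submodule.eq_bot_iff]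
  intro f hf
  have hfi : Integrable f μ := (Lp.memLp f).integrable (by norm_num)
  have hexp : ∀ x : StrongDual ℂ E,
      ∫ z, f z * Complex.exp (Complex.I * ((x z).re : ℂ)) ∂μ = 0 := by
    intro x
    have h1 := (Submodule.mem_orthogonal _ _).1 hf (charLp μ (-x))
      (Submodule.subset_span ⟨_, rfl⟩)
    rw [L2.inner_def] at h1
    rw [← h1]
    refine integral_congr_ae ?_
    filter_upwards [(memLp_exp_re μ (-x)).coeFn_toLp] with z hz
    rw [charLp, hz, RCLike.inner_apply, ← Complex.exp_conj]
    simp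
  have hmul : ∀ x : StrongDual ℂ E,
      Integrable (fun z => f z * Complex.exp (Complex.I * ((x z).re : ℂ))) μ := fun x =>
    hfi.mul_bdd (c := 1) (measurable_exp_re x).aestronglyMeasurable
      (ae_of_all _ fun z => (norm_exp_re x z).le)
  have hconj : ∀ x : StrongDual ℂ E,
      ∫ z, (starRingEnd ℂ) (f z) * Complex.exp (Complex.I * ((x z).re : ℂ)) ∂μ = 0 := by
    intro x
    have := congrArg (starRingEnd ℂ) (hexp (-x))
    rw [← integral_conj, map_zero] at this
    rw [← this]
    refine integral_congr_ae (ae_of_all _ fun z => ?_)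
    simp only [map_mul, ← Complex.exp_conj]
    simp
  have hmul' : ∀ x : StrongDual ℂ E, Integrable
      (fun z => (starRingEnd ℂ) (f z) * Complex.exp (Complex.I * ((x z).re : ℂ))) μ := fun x =>
    ((Complex.conjLIE.toContinuousLinearEquiv : ℂ →L[ℝ] ℂ).integrable_comp hfi).mul_bdd (c := 1)
      (measurable_exp_re x).aestronglyMeasurable (ae_of_all _ fun z => (norm_exp_re x z).le)
  have hre : (fun z => (f z).re) =ᵐ[μ] 0 := by
    refine ae_eq_zero_of_integral_mul_exp_re hfi.re fun x => ?_
    have := integral_add (hmul x) (hmul' x)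
    rw [hexp, hconj, add_zero] at this
    have h2 := congrArg (fun c : ℂ => c / 2) this
    simp only [← integral_div, zero_div] at h2
    rw [← h2]
    refine integral_congr_ae (ae_of_all _ fun z => ?_)
    change ((f z).re : ℂ) * _ = _
    rw [Complex.re_eq_add_conj]; ring
  have him : (fun z => (f z).im) =ᵐ[μ] 0 := by
    refine ae_eq_zero_of_integral_mul_exp_re hfi.im fun x => ?_
    have := integral_sub (hmul x) (hmul' x)
    rw [hexp, hconj, sub_zero] at this
    have h2 := congrArg (fun c : ℂ => c / (2 * Complex.I)) this
    simp only [← integral_div, zero_div] at h2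
    rw [← h2]
    refine integral_congr_ae (ae_of_all _ fun z => ?_)
    change ((f z).im : ℂ) * _ = _
    rw [Complex.im_eq_sub_conj]; ring
  refine (Lp.eq_zero_iff_ae_eq_zero).2 ?_
  filter_upwards [hre, him] with z h1 h2
  exact Complex.ext h1 h2

/-- A uniformly bounded sequence of continuous linear functionals that tends to `0` pointwise on a
set with dense span tends to `0` pointwise everywhere. -/
theorem tendsto_zero_of_span_dense {H : Type*} [NormedAddCommGroup H] [NormedSpace ℂ H]
    {S : Set H} (hS : (Submodule.span ℂ S).topologicalClosure = ⊤)
    (φ : ℕ → StrongDual ℂ H) {C : ℝ} (hC : ∀ n, ‖φ n‖ ≤ C)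
    (h : ∀ f ∈ S, Tendsto (fun n => φ n f) atTop (𝓝 0)) (f : H) :
    Tendsto (fun n => φ n f) atTop (𝓝 0) := by
  have hspan : ∀ g ∈ Submodule.span ℂ S, Tendsto (fun n => φ n g) atTop (𝓝 0) := by
    intro g hg
    induction hg using Submodule.span_induction with
    | mem x hx => exact h x hx
    | zero => simp
    | add x y _ _ hx hy => simpa using hx.add hy
    | smul a x _ hx => simpa using hx.const_mul a
  have hC0 : 0 ≤ C := (norm_nonneg _).trans (hC 0)
  rw [Metric.tendsto_atTop]
  intro ε hε
  have hf : f ∈ (Submodule.span ℂ S).topologicalClosure := hS ▸ Submodule.mem_top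
  -- `C + 1` replaces `C`, which may be `0`.
  obtain ⟨g, hg, hfg⟩ := Metric.mem_closure_iff.1 hf (ε / (2 * (C + 1))) (by positivity)
  obtain ⟨N, hN⟩ := Metric.tendsto_atTop.1 (hspan g hg) (ε / 2) (by positivity)
  refine ⟨N, fun n hn => ?_⟩
  have h1 := hN n hn
  rw [dist_zero_right] at h1 ⊢
  have h2 : ‖φ n (f - g)‖ ≤ C * ‖f - g‖ := (φ n).le_of_opNorm_le (hC n) _
  rw [dist_eq_norm] at hfg
  have h3 : C * ‖f - g‖ ≤ ε / 2 := by
    calc C * ‖f - g‖ ≤ (C + 1) * (ε / (2 * (C + 1))) := by gcongr; linarith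
      _ = ε / 2 := by field_simp
  calc ‖φ n f‖ = ‖φ n (f - g) + φ n g‖ := by rw [map_sub, sub_add_cancel]
    _ ≤ ‖φ n (f - g)‖ + ‖φ n g‖ := norm_add_le _ _
    _ < ε := by linarith

/-- A measure-preserving transformation is mixing as soon as the correlations of characters
converge to the product of the integrals. -/
theorem isMixing_of_tendsto_integral_exp_re [CompleteSpace E] [SecondCountableTopology E]
    {μ : Measure E} [IsProbabilityMeasure μ] {T : E → E} (hT : MeasurePreserving T μ μ)
    (h : ∀ x y : StrongDual ℂ E, Tendsto
      (fun n : ℕ => ∫ z, Complex.exp (Complex.I * ((x z).re : ℂ)) *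
        Complex.exp (Complex.I * ((y (T^[n] z)).re : ℂ)) ∂μ) atTop
      (𝓝 ((∫ z, Complex.exp (Complex.I * ((x z).re : ℂ)) ∂μ) *
        ∫ z, Complex.exp (Complex.I * ((y z).re : ℂ)) ∂μ))) :
    IsMixing T μ := by
  refine ⟨hT, fun A B hA hB => ?_⟩
  let one : Lp ℂ 2 μ := charLp μ 0
  have hone : (one : E → ℂ) =ᵐ[μ] fun _ => 1 := by
    filter_upwards with z
    simp [one, charLp]
  let U : ℕ → Lp ℂ 2 μ →ₗᵢ[ℂ] Lp ℂ 2 μ := fun n =>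
    Lp.compMeasurePreservingₗᵢ ℂ (T^[n]) (hT.iterate n)
  -- `P` projects onto the constants; mixing says that `V n`, the Koopman power minus `P`, tends
  -- weakly to `0`.
  let P : Lp ℂ 2 μ →L[ℂ] Lp ℂ 2 μ := (innerSL ℂ one).smulRight one
  let V : ℕ → Lp ℂ 2 μ →L[ℂ] Lp ℂ 2 μ := fun n => (U n).toContinuousLinearMap - P
  have hV : ∀ n, ‖V n‖ ≤ 1 + ‖P‖ := fun n =>
    (norm_sub_le _ _).trans (add_le_add_left (U n).norm_toContinuousLinearMap_le _)
  have hVapp : ∀ n f g, inner ℂ f (V n g)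
      = inner ℂ f (U n g) - inner ℂ one g * inner ℂ f one := fun n f g => by
    simp [V, P, inner_sub_right, inner_smul_right]
  have hchar : ∀ x y : StrongDual ℂ E,
      Tendsto (fun n => inner ℂ (charLp μ x) (V n (charLp μ y))) atTop (𝓝 0) := by
    intro x y
    have e1 : ∀ n, inner ℂ (charLp μ x) (U n (charLp μ y))
        = ∫ z, Complex.exp (Complex.I * (((-x) z).re : ℂ)) *
            Complex.exp (Complex.I * ((y (T^[n] z)).re : ℂ)) ∂μ := by
      intro n
      rw [L2.inner_def]
      refine integral_congr_ae ?_
      have h2 := Lp.coeFn_compMeasurePreserving (charLp μ y) (hT.iterate n)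
      have h3 := (hT.iterate n).quasiMeasurePreserving.ae (memLp_exp_re μ y).coeFn_toLp
      filter_upwards [(memLp_exp_re μ x).coeFn_toLp, h2, h3] with z hz1 hz2 hz3
      have hz2' : (U n (charLp μ y) : E → ℂ) z = (charLp μ y) (T^[n] z) := hz2
      rw [charLp, hz1, hz2', charLp, hz3, RCLike.inner_apply, ← Complex.exp_conj, mul_comm]
      simp
    have e2 : inner ℂ one (charLp μ y) = ∫ z, Complex.exp (Complex.I * ((y z).re : ℂ)) ∂μ := by
      rw [L2.inner_def]
      refine integral_congr_ae ?_
      filter_upwards [hone, (memLp_exp_re μ y).coeFn_toLp] with z hz1 hz2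
      rw [hz1, charLp, hz2, RCLike.inner_apply]
      simp
    have e3 : inner ℂ (charLp μ x) one
        = ∫ z, Complex.exp (Complex.I * (((-x) z).re : ℂ)) ∂μ := by
      rw [L2.inner_def]
      refine integral_congr_ae ?_
      filter_upwards [hone, (memLp_exp_re μ x).coeFn_toLp] with z hz1 hz2
      rw [hz1, charLp, hz2, RCLike.inner_apply, ← Complex.exp_conj]
      simp
    have := (h (-x) y).sub_const ((∫ z, Complex.exp (Complex.I * (((-x) z).re : ℂ)) ∂μ) *
        ∫ z, Complex.exp (Complex.I * ((y z).re : ℂ)) ∂μ)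
    rw [sub_self] at this
    refine this.congr fun n => ?_
    rw [hVapp, e1, e2, e3, mul_comm (∫ z, Complex.exp (Complex.I * ((y z).re : ℂ)) ∂μ)]
  have hdense := span_range_charLp_topologicalClosure μ
  -- Density is applied to one argument at a time, first the left, then the right.
  have hleft : ∀ (f : Lp ℂ 2 μ) (y : StrongDual ℂ E),
      Tendsto (fun n => inner ℂ f (V n (charLp μ y))) atTop (𝓝 0) := by
    intro f y
    have := tendsto_zero_of_span_dense hdense (fun n => innerSL ℂ (V n (charLp μ y)))
      (C := (1 + ‖P‖) * ‖charLp μ y‖)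
      (fun n => by
        rw [innerSL_apply_norm]
        exact (V n).le_of_opNorm_le (hV n) _) (by
        rintro _ ⟨x, rfl⟩
        have := (Complex.continuous_conj.tendsto 0).comp (hchar x y)
        simpa [Function.comp_def] using this) f
    have := (Complex.continuous_conj.tendsto 0).comp this
    simpa [Function.comp_def] using this
  have hall : ∀ f g : Lp ℂ 2 μ, Tendsto (fun n => inner ℂ f (V n g)) atTop (𝓝 0) := by
    intro f g
    refine tendsto_zero_of_span_dense hdense (fun n => (innerSL ℂ f).comp (V n))
      (C := ‖f‖ * (1 + ‖P‖)) (fun n => ?_) ?_ g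
    · refine (ContinuousLinearMap.opNorm_comp_le _ _).trans ?_
      rw [innerSL_apply_norm]
      exact mul_le_mul_of_nonneg_left (hV n) (norm_nonneg _)
    · rintro _ ⟨y, rfl⟩
      exact hleft f y
  have hone' : one = indicatorConstLp 2 MeasurableSet.univ (measure_ne_top μ _) (1 : ℂ) := by
    refine Lp.ext (hone.trans ?_)
    filter_upwards [indicatorConstLp_coeFn (p := 2) (hs := MeasurableSet.univ)
      (hμs := measure_ne_top μ Set.univ) (c := (1 : ℂ))] with z hz
    rw [hz]; simp
  have key : ∀ n, inner ℂ (indicatorConstLp 2 hA (measure_ne_top μ A) (1 : ℂ))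
      (V n (indicatorConstLp 2 hB (measure_ne_top μ B) (1 : ℂ)))
      = ((μ.real (A ∩ T^[n] ⁻¹' B) - μ.real A * μ.real B : ℝ) : ℂ) := by
    intro n
    have : U n (indicatorConstLp 2 hB (measure_ne_top μ B) (1 : ℂ))
        = indicatorConstLp 2 ((hT.iterate n).measurable hB) (measure_ne_top μ _) (1 : ℂ) :=
      Lp.indicatorConstLp_compMeasurePreserving hB (measure_ne_top μ B) 1 (hT.iterate n)
    rw [hVapp, this, hone']
    simp only [L2.inner_indicatorConstLp_one_indicatorConstLp_one]
    simp [mul_comm]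
  have hlim := hall (indicatorConstLp 2 hA (measure_ne_top μ A) (1 : ℂ))
    (indicatorConstLp 2 hB (measure_ne_top μ B) (1 : ℂ))
  simp only [key] at hlim
  have hlim' : Tendsto (fun n => μ.real (A ∩ T^[n] ⁻¹' B) - μ.real A * μ.real B) atTop (𝓝 0) := by
    simpa [Function.comp_def, ← Complex.ofReal_mul] using
      (Complex.continuous_re.tendsto 0).comp hlim
  rw [tendsto_sub_nhds_zero_iff] at hlim'
  have := ENNReal.tendsto_ofReal hlim'
  rw [ENNReal.ofReal_mul measureReal_nonneg] at this
  simpa using this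

end Mixing

/-! ### Geometric decay of the weight sequence. -/

section Weights

theorem weightSeq_pos {ω : ℤ → ℝ} (hω : ∀ n, 0 < ω n) {k₀ : ℝ} (hk₀ : 0 < k₀) (n : ℤ) :
    0 < weightSeq ω k₀ n := by
  unfold weightSeq
  split_ifs
  · exact mul_pos hk₀ (Finset.prod_pos fun l _ => one_div_pos.2 (hω l))
  · exact mul_pos hk₀ (Finset.prod_pos fun l _ => hω l)

/-- Besides positivity, this recursion is all that is used of the explicit formula; at `n = -1` the
two branches match. -/
theorem weightSeq_succ {ω : ℤ → ℝ} (hω : ∀ n, 0 < ω n) (k₀ : ℝ) (n : ℤ) :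
    weightSeq ω k₀ (n + 1) = ω (n + 1) * weightSeq ω k₀ n := by
  have hne := (hω (n + 1)).ne'
  rcases lt_trichotomy n (-1) with h | rfl | h
  · have hI : Finset.Icc (n + 1) 0 = insert (n + 1) (Finset.Icc (n + 1 + 1) 0) := by
      ext l; simp only [Finset.mem_Icc, Finset.mem_insert]; omega
    rw [weightSeq, weightSeq, if_pos (by omega), if_pos (by omega), hI,
      Finset.prod_insert (by simp)]
    field_simp
  · norm_num at hne
    simp [weightSeq]
    field_simp
  · have hI : Finset.Icc 1 (n + 1) = insert (n + 1) (Finset.Icc 1 n) := by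
      ext l; simp only [Finset.mem_Icc, Finset.mem_insert]; omega
    rw [weightSeq, weightSeq, if_neg (by omega), if_neg (by omega), hI,
      Finset.prod_insert (by simp)]
    ring

/-- A nonnegative sequence with eventual ratio at most `a` is dominated by a multiple of `a ^ j`. -/
theorem exists_le_mul_pow {u : ℕ → ℝ} (hu : ∀ j, 0 ≤ u j) {a : ℝ} (ha : 0 < a) (q : ℕ)
    (h : ∀ j, q ≤ j → u (j + 1) ≤ a * u j) : ∃ C : ℝ, ∀ j, u j ≤ C * a ^ j := by
  -- The sum dominates each of the finitely many initial ratios `u j / a ^ j`.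
  refine ⟨∑ j ∈ Finset.range (q + 1), u j / a ^ j, fun j => ?_⟩
  have hsmall : ∀ j, j ≤ q → u j ≤ (∑ j ∈ Finset.range (q + 1), u j / a ^ j) * a ^ j := by
    intro j hj
    rw [← div_le_iff₀ (pow_pos ha j)]
    exact Finset.single_le_sum (f := fun j => u j / a ^ j)
      (fun i _ => div_nonneg (hu i) (pow_pos ha i).le) (Finset.mem_range.2 (by omega))
  rcases le_total j q with hj | hj
  · exact hsmall j hj
  · induction j, hj using Nat.le_induction with
    | base => exact hsmall q le_rfl
    | succ j hj ih =>
      calc u (j + 1) ≤ a * u j := h j hj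
        _ ≤ a * (_ * a ^ j) := mul_le_mul_of_nonneg_left ih ha.le
        _ = _ := by ring

/-- The critical range is `m = -j` with `0 ≤ j ≤ n`, where the bound is `(r ρ)^j ρ^(n-j) = ρ^n r^j`:
the gap between the two tail rates becomes decay in `|m|`. Outside it both indices lie on one side
of `0`, leaving surplus powers. -/
theorem mul_add_le_of_geometric_tails {k : ℤ → ℝ} (hk : ∀ n, 0 ≤ k n) {C ρ r t : ℝ} (hC : 0 ≤ C)
    (hρ0 : 0 < ρ) (hρ1 : ρ ≤ 1) (hr0 : 0 ≤ r) (hr1 : r ≤ 1) (hrt : r ≤ t) (hρt : ρ ≤ t)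
    (hpos : ∀ j : ℕ, k j ≤ C * ρ ^ j) (hneg : ∀ j : ℕ, k (-j) ≤ C * (r * ρ) ^ j)
    (m : ℤ) (n : ℕ) : k m * k (m + n) ≤ C ^ 2 * (ρ ^ n * t ^ m.natAbs) := by
  have hle1 : ∀ {a : ℝ} (i : ℕ), 0 ≤ a → a ≤ 1 → a ^ i ≤ 1 := fun i h0 h1 => pow_le_one₀ h0 h1
  obtain ⟨j, rfl | rfl⟩ := m.eq_nat_or_neg
  · have h1 := hpos (j + n)
    push_cast at h1
    calc k j * k (j + n) ≤ (C * ρ ^ j) * (C * ρ ^ (j + n)) :=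
          mul_le_mul (hpos j) h1 (hk _) (by positivity)
      _ = C ^ 2 * (ρ ^ n * (ρ ^ j * ρ ^ j)) := by ring
      _ ≤ C ^ 2 * (ρ ^ n * (t ^ j * 1)) := by
          have ht := hρ0.le.trans hρt
          gcongr
          exact hle1 j hρ0.le hρ1
      _ = _ := by simp
  · rw [Int.natAbs_neg, Int.natAbs_natCast]
    rcases le_total j n with hjn | hjn
    · obtain ⟨i, rfl⟩ := Nat.exists_eq_add_of_le hjn
      have e : (-(j : ℤ) + ((j + i : ℕ) : ℤ)) = i := by push_cast; ring
      rw [e]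
      calc k (-j) * k i ≤ (C * (r * ρ) ^ j) * (C * ρ ^ i) :=
            mul_le_mul (hneg j) (hpos i) (hk _) (by positivity)
        _ = C ^ 2 * (ρ ^ (j + i) * r ^ j) := by ring
        _ ≤ _ := by gcongr
    · obtain ⟨i, rfl⟩ := Nat.exists_eq_add_of_le hjn
      have e : (-((n + i : ℕ) : ℤ) + (n : ℤ)) = -i := by push_cast; ring
      rw [e]
      calc k (-((n + i : ℕ) : ℤ)) * k (-i) ≤ (C * (r * ρ) ^ (n + i)) * (C * (r * ρ) ^ i) :=
            mul_le_mul (hneg _) (hneg i) (hk _) (by positivity)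
        _ = C ^ 2 * (ρ ^ n * (r ^ (n + i) * (ρ ^ i * (r * ρ) ^ i))) := by ring
        _ ≤ C ^ 2 * (ρ ^ n * (t ^ (n + i) * (1 * 1))) := by
            gcongr
            · exact (pow_nonneg hr0 _).trans (pow_le_pow_left₀ hr0 hrt _)
            · exact hle1 i hρ0.le hρ1
            · exact hle1 i (by positivity) (mul_le_one₀ hr1 hρ0.le hρ1)
        _ = _ := by ring

theorem summable_rpow_pow_natAbs {t s : ℝ} (ht0 : 0 ≤ t) (ht1 : t < 1) (hs : 0 < s) :
    Summable fun m : ℤ => (t ^ m.natAbs) ^ s := by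
  have h : Summable fun j : ℕ => (t ^ s) ^ j :=
    summable_geometric_of_lt_one (Real.rpow_nonneg ht0 s) (Real.rpow_lt_one ht0 ht1 hs)
  have e : ∀ j : ℕ, (t ^ s) ^ j = (t ^ j) ^ s := fun j => by
    rw [← Real.rpow_natCast, ← Real.rpow_natCast, ← Real.rpow_mul ht0, ← Real.rpow_mul ht0,
      mul_comm]
  simp only [e] at h
  exact Summable.of_nat_of_neg (by simpa using h) (by simpa using h)

/-- The products `k m * k (m + n)` decay geometrically in `n` and in `|m|`. -/
theorem exists_weightSeq_mul_le {ω : ℤ → ℝ} (hω : ∀ n, 0 < ω n) {k₀ : ℝ} (hk₀ : 0 < k₀)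
    {qm qp : ℕ} {ηm ρ : ℝ} (hm0 : 0 < ηm) (hm : ∀ l : ℤ, l ≤ -(qm : ℤ) → 1 / ω l ≤ ηm)
    (hp : ∀ l : ℤ, (qp : ℤ) ≤ l → ω l ≤ ρ) (hρm : ηm < ρ) (hρ1 : ρ < 1) :
    ∃ C t : ℝ, 0 ≤ C ∧ 0 ≤ t ∧ t < 1 ∧ ∀ (m : ℤ) (n : ℕ),
      weightSeq ω k₀ m * weightSeq ω k₀ (m + n) ≤ C * (ρ ^ n * t ^ m.natAbs) := by
  have hρ0 : 0 < ρ := hm0.trans hρm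
  have hk := weightSeq_pos hω hk₀
  obtain ⟨C₁, h₁⟩ := exists_le_mul_pow (u := fun j : ℕ => weightSeq ω k₀ j)
    (fun j => (hk _).le) hρ0 qp (fun j hj => by
      push_cast
      rw [weightSeq_succ hω]
      exact mul_le_mul_of_nonneg_right (hp _ (by omega)) (hk _).le)
  obtain ⟨C₂, h₂⟩ := exists_le_mul_pow (u := fun j : ℕ => weightSeq ω k₀ (-j))
    (fun j => (hk _).le) hm0 qm (fun j hj => by
      have h := weightSeq_succ hω k₀ (-((j + 1 : ℕ) : ℤ))
      have e : -((j + 1 : ℕ) : ℤ) + 1 = -j := by push_cast; ring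
      rw [e] at h
      have hj' := hm (-j) (by omega)
      rw [h, ← mul_assoc]
      refine le_mul_of_one_le_left (hk _).le ?_
      rwa [div_le_iff₀ (hω _)] at hj')
  have hr : ηm / ρ * ρ = ηm := div_mul_cancel₀ _ hρ0.ne'
  have hr1 : ηm / ρ < 1 := (div_lt_one hρ0).2 hρm
  refine ⟨(max C₁ C₂) ^ 2, max (ηm / ρ) ρ, sq_nonneg _, hρ0.le.trans (le_max_right _ _),
    max_lt hr1 hρ1, ?_⟩
  have hC₁ : 0 ≤ C₁ := by simpa using (hk 0).le.trans (by simpa using h₁ 0)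
  refine mul_add_le_of_geometric_tails (fun n => (hk n).le) (hC₁.trans (le_max_left _ _)) hρ0
    hρ1.le (div_pos hm0 hρ0).le hr1.le (le_max_left _ _) (le_max_right _ _)
    (fun j => (h₁ j).trans ?_) (fun j => (h₂ j).trans ?_)
  · gcongr
    exact le_max_left _ _
  · rw [hr]
    gcongr
    exact le_max_right _ _

end Weights

/-! ### The weighted shift: invariance, decay, mixing. -/

section WeightedShift

variable {p : ℝ≥0} [Fact (1 ≤ (p : ℝ≥0∞))] {ω : ℤ → ℝ} {k₀ : ℝ} {T : EllP p →L[ℂ] EllP p}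

/-- On the rescaled vectors `k_m e_m`, `T` acts as the unweighted shift. -/
theorem weightSeq_smul_pow_basisVec (hω : ∀ n, 0 < ω n)
    (hT : ∀ n : ℤ, T (basisVec p n) = (ω (n + 1) : ℂ) • basisVec p (n + 1)) (n : ℕ) (m : ℤ) :
    (weightSeq ω k₀ m : ℂ) • (T ^ n) (basisVec p m)
      = (weightSeq ω k₀ (m + n) : ℂ) • basisVec p (m + n) := by
  induction n generalizing m with
  | zero => simp
  | succ n ih =>
    have h := ih (m + 1)
    rw [weightSeq_succ hω, Complex.ofReal_mul] at h
    rw [show m + ((n + 1 : ℕ) : ℤ) = m + 1 + n by push_cast; ring, ← h, pow_succ,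
      show (T ^ n * T) (basisVec p m) = (T ^ n) (T (basisVec p m)) from rfl, hT, map_smul,
      smul_smul, mul_comm]

theorem norm_weightSeq_mul_adjPow (hω : ∀ n, 0 < ω n) (hk₀ : 0 < k₀)
    (hT : ∀ n : ℤ, T (basisVec p n) = (ω (n + 1) : ℂ) • basisVec p (n + 1))
    (y : StrongDual ℂ (EllP p)) (n : ℕ) (m : ℤ) :
    weightSeq ω k₀ m * ‖adjPow T n y (basisVec p m)‖
      = weightSeq ω k₀ (m + n) * ‖y (basisVec p (m + n))‖ := by
  have h := congrArg (fun z => ‖y z‖) (weightSeq_smul_pow_basisVec (k₀ := k₀) hω hT n m)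
  simpa [adjPow, abs_of_pos (weightSeq_pos hω hk₀ _)] using h

theorem stableExponent_comp_shift {α : ℝ} (hω : ∀ n, 0 < ω n) (hk₀ : 0 < k₀)
    (hT : ∀ n : ℤ, T (basisVec p n) = (ω (n + 1) : ℂ) • basisVec p (n + 1))
    (x : StrongDual ℂ (EllP p)) :
    stableExponent α (weightSeq ω k₀) (fun n => x (T (basisVec p n)))
      = stableExponent α (weightSeq ω k₀) fun n => x (basisVec p n) := by
  refine Eq.trans (tsum_congr fun n => ?_) ((Equiv.addRight (1 : ℤ)).tsum_eq fun n =>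
    weightSeq ω k₀ n ^ α / 2 * (|(x (basisVec p n)).re| ^ α + |(x (basisVec p n)).im| ^ α))
  rw [Equiv.coe_addRight, weightSeq_succ hω,
    Real.mul_rpow (hω _).le (weightSeq_pos hω hk₀ n).le]
  simp only [hT, map_smul, smul_eq_mul, Complex.re_ofReal_mul, Complex.im_ofReal_mul, abs_mul,
    abs_of_pos (hω (n + 1)), Real.mul_rpow (hω (n + 1)).le (abs_nonneg _)]
  ring

theorem stableExponent_adjPow {α : ℝ} (hω : ∀ n, 0 < ω n) (hk₀ : 0 < k₀)
    (hT : ∀ n : ℤ, T (basisVec p n) = (ω (n + 1) : ℂ) • basisVec p (n + 1)) (n : ℕ)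
    (x : StrongDual ℂ (EllP p)) :
    stableExponent α (weightSeq ω k₀) (fun m => adjPow T n x (basisVec p m))
      = stableExponent α (weightSeq ω k₀) fun m => x (basisVec p m) := by
  induction n with
  | zero => simp [adjPow]
  | succ n ih =>
    rw [← ih, ← stableExponent_comp_shift hω hk₀ hT (adjPow T n x)]
    simp only [adjPow, pow_succ]
    rfl

variable [MeasurableSpace (EllP p)] [BorelSpace (EllP p)] {α : ℝ} {μ : Measure (EllP p)}

/-- A weighted shift preserves the associated stable measure. -/
theorem IsStableWithControl.measurePreserving_shift [IsFiniteMeasure μ]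
    (hμ : IsStableWithControl α (controlMeasure p α (weightSeq ω k₀)) μ) (h0 : 0 < α)
    (hω : ∀ n, 0 < ω n) (hk₀ : 0 < k₀) (hk : Summable fun n => weightSeq ω k₀ n ^ α)
    (hT : ∀ n : ℤ, T (basisVec p n) = (ω (n + 1) : ℂ) • basisVec p (n + 1)) :
    MeasurePreserving T μ μ := by
  have hTm : Measurable T := T.continuous.measurable
  refine ⟨hTm, ext_of_integral_exp_re fun x => ?_⟩
  rw [integral_map hTm.aemeasurable (measurable_exp_re x).aestronglyMeasurable]
  have hkn := fun n => (weightSeq_pos hω hk₀ n).le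
  have h := hμ.integral_exp_re h0 hkn hk (x.comp T)
  simp only [ContinuousLinearMap.comp_apply, stableExponent_comp_shift hω hk₀ hT] at h
  rw [h, hμ.integral_exp_re h0 hkn hk]

/-- Exponential decay of codifferences under a weighted shift. -/
theorem IsStableWithControl.exists_norm_codiffEq_adjPow_le
    (hμ : IsStableWithControl α (controlMeasure p α (weightSeq ω k₀)) μ)
    (h0 : 0 < α) (h2 : α ≤ 2) (hω : ∀ n, 0 < ω n) (hk₀ : 0 < k₀)
    (hk : Summable fun n => weightSeq ω k₀ n ^ α)
    (hT : ∀ n : ℤ, T (basisVec p n) = (ω (n + 1) : ℂ) • basisVec p (n + 1))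
    {qm qp : ℕ} {ηm ρ : ℝ} (hm0 : 0 < ηm) (hm : ∀ l : ℤ, l ≤ -(qm : ℤ) → 1 / ω l ≤ ηm)
    (hp : ∀ l : ℤ, (qp : ℤ) ≤ l → ω l ≤ ρ) (hρm : ηm < ρ) (hρ1 : ρ < 1) :
    ∃ K : ℝ, 0 < K ∧ ∀ (n : ℕ) (x y : StrongDual ℂ (EllP p)),
      ‖codiffEq μ x (adjPow T n y)‖
        ≤ K * ρ ^ (α * n / 2) * (‖x‖ ^ (α / 2) * ‖y‖ ^ (α / 2)) := by
  obtain ⟨C, t, hC, ht0, ht1, hCt⟩ := exists_weightSeq_mul_le hω hk₀ hm0 hm hp hρm hρ1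
  have hρ0 : 0 < ρ := hm0.trans hρm
  have hs : 0 < α / 2 := by positivity
  have hkn := fun n => (weightSeq_pos hω hk₀ n).le
  have hsum := summable_rpow_pow_natAbs ht0 ht1 hs
  set S := ∑' m : ℤ, (t ^ m.natAbs) ^ (α / 2) with hS
  have hS0 : 0 ≤ S := tsum_nonneg fun m => by positivity
  -- The `+ 1` only ensures positivity.
  refine ⟨4 * C ^ (α / 2) * S + 1, by positivity, fun n x y => ?_⟩
  have hterm : ∀ m, weightSeq ω k₀ m ^ α * (‖x (basisVec p m)‖ ^ (α / 2) *
      ‖adjPow T n y (basisVec p m)‖ ^ (α / 2))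
      ≤ C ^ (α / 2) * ρ ^ (α * n / 2) * (‖x‖ ^ (α / 2) * ‖y‖ ^ (α / 2)) *
        (t ^ m.natAbs) ^ (α / 2) := by
    intro m
    have e1 : weightSeq ω k₀ m ^ α
        = weightSeq ω k₀ m ^ (α / 2) * weightSeq ω k₀ m ^ (α / 2) := by
      rw [← Real.rpow_add_of_nonneg (hkn m) hs.le hs.le, add_halves]
    have e2 : ρ ^ (α * n / 2) = (ρ ^ n) ^ (α / 2) := by
      rw [← Real.rpow_natCast, ← Real.rpow_mul hρ0.le]
      congr 1; ring
    have hx := norm_apply_basisVec_le x m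
    have hy := norm_apply_basisVec_le y (m + n)
    -- One half of `k_m ^ α` goes with `x`; the other turns `T^{*n} y` at `m` into `y` at `m + n`.
    calc _ = (weightSeq ω k₀ m * ‖x (basisVec p m)‖ *
          (weightSeq ω k₀ m * ‖adjPow T n y (basisVec p m)‖)) ^ (α / 2) := by
          rw [e1, Real.mul_rpow (mul_nonneg (hkn m) (norm_nonneg _))
            (mul_nonneg (hkn m) (norm_nonneg _)), Real.mul_rpow (hkn m) (norm_nonneg _),
            Real.mul_rpow (hkn m) (norm_nonneg _)]
          ring
      _ = (weightSeq ω k₀ m * weightSeq ω k₀ (m + n) *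
          (‖x (basisVec p m)‖ * ‖y (basisVec p (m + n))‖)) ^ (α / 2) := by
          rw [norm_weightSeq_mul_adjPow hω hk₀ hT]
          congr 1; ring
      _ ≤ (C * (ρ ^ n * t ^ m.natAbs) * (‖x‖ * ‖y‖)) ^ (α / 2) := by
          have h1 := hkn m
          have h2 := hkn (m + n)
          refine Real.rpow_le_rpow (by positivity) ?_ hs.le
          exact mul_le_mul (hCt m n) (mul_le_mul hx hy (norm_nonneg _) (norm_nonneg _))
            (by positivity) (by positivity)
      _ = _ := by
          rw [e2, Real.mul_rpow (by positivity) (by positivity),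
            Real.mul_rpow hC (by positivity), Real.mul_rpow (by positivity) (by positivity),
            Real.mul_rpow (norm_nonneg _) (norm_nonneg _)]
          ring
  have hmaj := hsum.mul_left
    (C ^ (α / 2) * ρ ^ (α * n / 2) * (‖x‖ ^ (α / 2) * ‖y‖ ^ (α / 2)))
  have hxy := Summable.of_nonneg_of_le (fun m => mul_nonneg (Real.rpow_nonneg (hkn m) α)
    (by positivity)) hterm hmaj
  rw [hμ.codiffEq_eq h0 hkn hk, Complex.norm_real, Real.norm_eq_abs]
  calc _ ≤ 4 * ∑' m, weightSeq ω k₀ m ^ α * (‖x (basisVec p m)‖ ^ (α / 2) *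
      ‖adjPow T n y (basisVec p m)‖ ^ (α / 2)) :=
        abs_stableExponent_codifference_le h0 h2 hkn hk (norm_apply_basisVec_le x)
          (norm_apply_basisVec_le (adjPow T n y)) hxy
    _ ≤ 4 * (C ^ (α / 2) * ρ ^ (α * n / 2) * (‖x‖ ^ (α / 2) * ‖y‖ ^ (α / 2)) * S) := by
        refine mul_le_mul_of_nonneg_left ?_ (zero_le_four (α := ℝ))
        rw [hS, ← tsum_mul_left]
        exact hxy.tsum_le_tsum hterm hmaj
    _ = 4 * C ^ (α / 2) * S * ρ ^ (α * n / 2) * (‖x‖ ^ (α / 2) * ‖y‖ ^ (α / 2)) := by ring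
    _ ≤ _ := by
        gcongr
        linarith

/-- Decay of codifferences implies mixing of the weighted shift. -/
theorem IsStableWithControl.isMixing_shift [IsProbabilityMeasure μ]
    (hμ : IsStableWithControl α (controlMeasure p α (weightSeq ω k₀)) μ)
    (h0 : 0 < α) (hω : ∀ n, 0 < ω n) (hk₀ : 0 < k₀)
    (hk : Summable fun n => weightSeq ω k₀ n ^ α)
    (hT : ∀ n : ℤ, T (basisVec p n) = (ω (n + 1) : ℂ) • basisVec p (n + 1))
    (hcod : ∀ x y : StrongDual ℂ (EllP p),
      Tendsto (fun n => codiffEq μ x (adjPow T n y)) atTop (𝓝 0)) :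
    IsMixing T μ := by
  refine isMixing_of_tendsto_integral_exp_re (hμ.measurePreserving_shift h0 hω hk₀ hk hT)
    fun x y => ?_
  have hkn := fun n => (weightSeq_pos hω hk₀ n).le
  -- The sign of `y` is flipped because the codifference involves `x - y`; the last factor is
  -- unaffected since the exponent is even.
  have key : ∀ n : ℕ, ∫ z, Complex.exp (Complex.I * ((x z).re : ℂ)) *
        Complex.exp (Complex.I * ((y (T^[n] z)).re : ℂ)) ∂μ
      = Complex.exp (codiffEq μ x (adjPow T n (-y))) *
        ((∫ z, Complex.exp (Complex.I * ((x z).re : ℂ)) ∂μ) *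
        ∫ z, Complex.exp (Complex.I * ((y z).re : ℂ)) ∂μ) := by
    intro n
    have e1 : ∫ z, Complex.exp (Complex.I * ((x z).re : ℂ)) *
        Complex.exp (Complex.I * ((y (T^[n] z)).re : ℂ)) ∂μ
        = ∫ z, Complex.exp (Complex.I * (((x - adjPow T n (-y)) z).re : ℂ)) ∂μ := by
      refine integral_congr_ae (ae_of_all _ fun z => ?_)
      simp [adjPow, ← Complex.exp_add, mul_add]
    have e2 : stableExponent α (weightSeq ω k₀) (fun m => adjPow T n (-y) (basisVec p m))
        = stableExponent α (weightSeq ω k₀) fun m => y (basisVec p m) := by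
      rw [stableExponent_adjPow hω hk₀ hT]
      simp [stableExponent]
    rw [e1, hμ.codiffEq_eq h0 hkn hk, hμ.integral_exp_re h0 hkn hk,
      hμ.integral_exp_re h0 hkn hk, hμ.integral_exp_re h0 hkn hk, e2, ← Complex.ofReal_exp,
      ← Complex.ofReal_mul, ← Complex.ofReal_mul, ← Real.exp_add, ← Real.exp_add]
    congr 2
    simp only [sub_apply]
    ring
  simp only [key]
  have := ((Complex.continuous_exp.tendsto 0).comp (hcod x (-y))).mul_const
    ((∫ z, Complex.exp (Complex.I * ((x z).re : ℂ)) ∂μ) *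
        ∫ z, Complex.exp (Complex.I * ((y z).re : ℂ)) ∂μ)
  rwa [Complex.exp_zero, one_mul] at this

end WeightedShift

/-! ### Choice of the rate and conclusion. -/

theorem proposition5p2
    (p : ℝ≥0) [Fact (1 ≤ (p : ℝ≥0∞))]
    [MeasurableSpace (EllP p)] [BorelSpace (EllP p)]
    (α : ℝ) (hα0 : 0 < α) (hα2 : α < 2) (hα1 : α ≠ 1)
    (ω : ℤ → ℝ) (hω : ∀ n, 0 < ω n)
    (k₀ : ℝ) (hk₀ : 0 < k₀)
    (hk : Memℓp (weightSeq ω k₀) (ENNReal.ofReal α))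
    (μ : Measure (EllP p)) [IsProbabilityMeasure μ]
    (hμ : IsStableWithControl α (controlMeasure p α (weightSeq ω k₀)) μ)
    (T : EllP p →L[ℂ] EllP p)
    (hT : ∀ n : ℤ, T (basisVec p n) = (ω (n + 1) : ℂ) • basisVec p (n + 1)) :
    MeasurePreserving T μ μ ∧
    (α < p → (p : ℝ) ≤ 2 →
      ∀ (qm qp : ℕ), 1 ≤ qp →
      ∀ (ηm ηp : ℝ),
        IsLUB {r : ℝ | ∃ l : ℤ, l ≤ -(qm : ℤ) ∧ r = 1 / ω l} ηm → ηm < 1 →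
        IsLUB {r : ℝ | ∃ l : ℤ, (qp : ℤ) ≤ l ∧ r = ω l} ηp → ηp < 1 →
        ηp ^ ((p : ℝ) / 2) ≠ ηm ^ (α - (p : ℝ) / 2) →
        (∃ K : ℝ, 0 < K ∧ ∀ n : ℕ, ∀ x y : StrongDual ℂ (EllP p), x ≠ 0 → y ≠ 0 →
          ‖codiffEq μ x (adjPow T n y)‖ / (‖x‖ ^ (α / 2) * ‖y‖ ^ (α / 2))
              ≤ K * max (ηm ^ (2 * α / (p : ℝ) - 1)) ηp ^ (α * (n : ℝ) / 2) ∧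
          ‖codiffNe μ x (adjPow T n y)‖ / (‖x‖ ^ (α / 2) * ‖y‖ ^ (α / 2))
              ≤ K * max (ηm ^ (2 * α / (p : ℝ) - 1)) ηp ^ (α * (n : ℝ) / 2)) ∧
        (1 / 2 < α → (p : ℝ) < 2 * α → IsMixing T μ)) := by
  have hkpos := weightSeq_pos hω hk₀
  have hks : Summable fun n => weightSeq ω k₀ n ^ α := by
    have h := (memℓp_gen_iff (by rwa [ENNReal.toReal_ofReal hα0.le])).1 hk
    simpa [ENNReal.toReal_ofReal hα0.le, abs_of_pos (hkpos _)] using h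
  refine ⟨hμ.measurePreserving_shift hα0 hω hk₀ hks hT, ?_⟩
  intro hαp _ qm qp _ ηm ηp hηm hηm1 hηp hηp1 _
  have hm : ∀ l : ℤ, l ≤ -(qm : ℤ) → 1 / ω l ≤ ηm := fun l hl => hηm.1 ⟨l, hl, rfl⟩
  have hm0 : 0 < ηm := (one_div_pos.2 (hω _)).trans_le (hm _ le_rfl)
  have hp0 : (0 : ℝ) < p := hα0.trans hαp
  have hexp1 : 2 * α / (p : ℝ) - 1 < 1 := by
    rw [sub_lt_iff_lt_add, div_lt_iff₀ hp0]; linarith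
  -- A rate below `1` that is at most the required one, which may exceed `1`.
  set θ := max (2 * α / (p : ℝ) - 1) (1 / 2) with hθ
  have hθ1 : θ < 1 := max_lt hexp1 (by norm_num)
  have hθ0 : 0 < θ := lt_of_lt_of_le (by norm_num) (le_max_right _ _)
  -- `θ < 1` gives the strict gap `ηm < ρ`, `θ > 0` gives `ρ < 1`, and `θ ≥ 2α/p - 1` keeps `ρ`
  -- below the required base.
  set ρ := max (ηm ^ θ) ηp with hρ
  have hρm : ηm < ρ := lt_of_lt_of_le
    (by simpa using Real.rpow_lt_rpow_of_exponent_gt hm0 hηm1 hθ1) (le_max_left _ _)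
  have hρ0 : 0 < ρ := hm0.trans hρm
  have hρ1 : ρ < 1 := max_lt (Real.rpow_lt_one hm0.le hηm1 hθ0) hηp1
  have hρR : ρ ≤ max (ηm ^ (2 * α / (p : ℝ) - 1)) ηp :=
    max_le_max (Real.rpow_le_rpow_of_exponent_ge hm0 hηm1.le (le_max_left _ _)) le_rfl
  have hp : ∀ l : ℤ, (qp : ℤ) ≤ l → ω l ≤ ρ := fun l hl =>
    (hηp.1 ⟨l, hl, rfl⟩).trans (le_max_right _ _)
  obtain ⟨K, hK, hbound⟩ :=
    hμ.exists_norm_codiffEq_adjPow_le hα0 hα2.le hω hk₀ hks hT hm0 hm hp hρm hρ1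
  refine ⟨⟨K, hK, fun n x y hx hy => ?_⟩, fun _ _ => ?_⟩
  · have hx' : 0 < ‖x‖ := norm_pos_iff.2 hx
    have hy' : 0 < ‖y‖ := norm_pos_iff.2 hy
    have hR : K * ρ ^ (α * n / 2)
        ≤ K * max (ηm ^ (2 * α / (p : ℝ) - 1)) ηp ^ (α * (n : ℝ) / 2) := by gcongr
    refine ⟨?_, ?_⟩
    · rw [div_le_iff₀ (by positivity)]
      exact (hbound n x y).trans (mul_le_mul_of_nonneg_right hR (by positivity))
    · have e : -(Complex.I • adjPow T n y) = adjPow T n (-(Complex.I • y)) := by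
        ext z; simp [adjPow]
      have h := hbound n x (-(Complex.I • y))
      rw [norm_neg, norm_smul, Complex.norm_I, one_mul] at h
      rw [div_le_iff₀ (by positivity), codiffNe_eq_codiffEq, e]
      exact h.trans (mul_le_mul_of_nonneg_right hR (by positivity))
  · refine hμ.isMixing_shift hα0 hω hk₀ hks hT fun x y => ?_
    refine squeeze_zero_norm (fun n => hbound n x y) ?_
    have hq : Tendsto (fun n : ℕ => ρ ^ (α * n / 2)) atTop (𝓝 0) := by
      have h := tendsto_pow_atTop_nhds_zero_of_lt_one (Real.rpow_nonneg hρ0.le (α / 2))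
        (Real.rpow_lt_one hρ0.le hρ1 (by positivity))
      refine h.congr fun n => ?_
      rw [← Real.rpow_natCast, ← Real.rpow_mul hρ0.le]
      congr 1; ring
    simpa using (hq.const_mul K).mul_const (‖x‖ ^ (α / 2) * ‖y‖ ^ (α / 2))
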